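/- Let $G=\prod_{j=0}^\infty Z_2$ be the Walsh group with its normalized Haar measure $\mu$, and let $\zeta_m$ be the $\sigma$-algebra generated by the dyadic intervals $I_m(x)=\{y\in G: y_0=x_0,\dots,y_{m-1}=x_{m-1}\}$. Let $w_k(x)=\prod_{j}(-1)^{k_jx_j}$ (where $k=\sum_j k_j2^j$, $k_j\in\{0,1\}$) be the Walsh functions. For a real martingale $F=(F_m)_{m\in\mathbb N}$ with respect to $(\zeta_m)$ put $F^*=\sup_{m}|F_m|$ and $\|F\|_{H_{1/2}}=\|F^*\|_{1/2}$, where $\|g\|_{1/2}=\left(\int_G|g|^{1/2}d\mu\right)^{2}$; $H_{1/2}(G)$ consists of the martingales with $\|F\|_{H_{1/2}}<\infty$. Put $$\widehat F(k)=\lim_{m\to\infty}\int_G F_m w_k\,d\mu,\qquad S_jF=\sum_{k=0}^{j-1}\widehat F(k)w_k,\qquad \sigma_jF=\frac1j\sum_{i=1}^{j}S_iF .$$ Let $n\ge 1$ be an integer. For $s\in\mathbb N$ and $0\le k\le[\sqrt[n]{s}]-1$ (where $[\cdot]$ denotes the integer part) let $$\alpha_k^s=2^s+2^0+2^1+\dots+2^k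 .$$ Then the restricted maximal operator $$\tilde\sigma_6^{*,\nabla}F:=\sup_{s\in\mathbb N}\ \sup_{0\le k\le[\sqrt[n]{s}]-1}\frac{|\sigma_{\alpha_k^s}F|}{\log^{2/n}\alpha_k^s}$$ (a supremum over no indices being $0$) is bounded from the Hardy space $H_{1/2}(G)$ to the Lebesgue space $L_{1/2}(G)$: there is a constant $c$, depending only on $n$, such that for every $F\in H_{1/2}(G)$ the function $\tilde\sigma_6^{*,\nabla}F$ belongs to $L_{1/2}(G)$ and $$\|\tilde\sigma_6^{*,\nabla}F\|_{1/2}\le c\,\|F\|_{H_{1/2}} .$$ In particular ($n=2$), for $0\le k\le[\sqrt s]-1$ the normalization $\log\alpha_k^s$ suffices. -/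

import Mathlib

open MeasureTheory ProbabilityTheory Filter Topology
open scoped ENNReal NNReal

noncomputable section

namespace WalshFejer

/-- The Walsh group `G`: the complete direct product of countably many copies of `Z_2`. -/
abbrev G : Type := ℕ → ZMod 2

/-- The Haar measure on `Z_2`: every singleton has measure `1/2`. -/
def z2Measure : Measure (ZMod 2) := (2 : ℝ≥0∞)⁻¹ • Measure.count

instance : IsProbabilityMeasure z2Measure := by
  constructor
  have h : (Measure.count (Set.univ : Set (ZMod 2)) : ℝ≥0∞) = 2 := by
    rw [Measure.count_univ]
    simp [ENat.card_eq_coe_fintype_card, ZMod.card]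
  rw [z2Measure, Measure.smul_apply, h, smul_eq_mul]
  exact ENNReal.inv_mul_cancel (by norm_num) (by norm_num)

/-- The normalized Haar measure `μ` on `G`: the product measure. -/
def haarG : Measure G := Measure.infinitePi (fun _ : ℕ => z2Measure)

instance : IsProbabilityMeasure haarG := by
  unfold haarG
  infer_instance

/-- The dyadic interval `I_n(x) = {y : y_0 = x_0, …, y_{n-1} = x_{n-1}}`. -/
def dyadicInterval (n : ℕ) (x : G) : Set G := {y | ∀ i < n, y i = x i}

theorem measurableSet_dyadicInterval (n : ℕ) (x : G) :
    MeasurableSet (dyadicInterval n x) := by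
  have h : dyadicInterval n x = ⋂ i : ℕ, ⋂ _ : i < n, (fun y : G => y i) ⁻¹' {x i} := by
    ext y
    simp [dyadicInterval]
  rw [h]
  exact MeasurableSet.iInter fun i => MeasurableSet.iInter fun _ =>
    (measurable_pi_apply i) (MeasurableSet.singleton _)

/-- The filtration `(ζ_n)`: `ζ_n` is the σ-algebra generated by the intervals `I_n(x)`, `x ∈ G`. -/
def dyadicFiltration : Filtration ℕ (inferInstance : MeasurableSpace G) where
  seq n := MeasurableSpace.generateFrom (Set.range (dyadicInterval n))
  mono' := by
    intro n m hnm
    refine MeasurableSpace.generateFrom_le ?_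
    rintro _ ⟨x, rfl⟩
    let ext : (Fin m → ZMod 2) → G := fun v i => if h : i < m then v ⟨i, h⟩ else 0
    have h : dyadicInterval n x =
        ⋃ v : Fin m → ZMod 2, ⋃ _ : ext v ∈ dyadicInterval n x, dyadicInterval m (ext v) := by
      ext y
      simp only [Set.mem_iUnion, exists_prop]
      constructor
      · intro hy
        refine ⟨fun i => y i, fun i hi => ?_, fun i hi => ?_⟩
        · simp only [ext, dif_pos (lt_of_lt_of_le hi hnm)]
          exact hy i hi
        · simp only [ext, dif_pos hi]
      · rintro ⟨v, hv, hy⟩ i hi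
        rw [hy i (lt_of_lt_of_le hi hnm), hv i hi]
    rw [h]
    exact MeasurableSet.iUnion fun v => MeasurableSet.iUnion fun _ =>
      MeasurableSpace.measurableSet_generateFrom ⟨_, rfl⟩
  le' := by
    intro n
    refine MeasurableSpace.generateFrom_le ?_
    rintro _ ⟨x, rfl⟩
    exact measurableSet_dyadicInterval n x

/-- The Rademacher function `r_k(x) = (-1)^{x_k}`. -/
def rademacher (k : ℕ) (x : G) : ℝ := (-1) ^ (x k).val

/-- The Walsh function `w_n(x) = ∏_k r_k(x)^{n_k}`, where `n_k` is the `k`-th binary digit of `n`.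
Since `n < 2 ^ n`, the digits `n_k` with `k ≥ n` vanish and the product is over `k < n`. -/
def walsh (n : ℕ) (x : G) : ℝ :=
  ∏ k ∈ Finset.range n, rademacher k x ^ (n.testBit k).toNat

/-- The maximal function `F^* = sup_n |F_n|`. -/
def maximalFunction (F : ℕ → G → ℝ) (x : G) : ℝ≥0∞ := ⨆ n, ‖F n x‖ₑ

/-- The Hardy quasi-norm `‖F‖_{H_p} = ‖F^*‖_p`. -/
def hardyNorm (p : ℝ≥0∞) (F : ℕ → G → ℝ) : ℝ≥0∞ := eLpNorm (maximalFunction F) p haarG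

/-- Membership in the martingale Hardy space `H_p(G)`. -/
def MemHardy (p : ℝ≥0∞) (F : ℕ → G → ℝ) : Prop :=
  Martingale F dyadicFiltration haarG ∧ hardyNorm p F < ∞

/-- The `k`-th Walsh–Fourier coefficient `lim_n ∫ F_n w_k dμ` of a martingale `F`
(for a martingale the sequence is eventually constant, so the limit exists). -/
def walshCoeff (F : ℕ → G → ℝ) (k : ℕ) : ℝ :=
  limUnder atTop (fun n => ∫ x, F n x * walsh k x ∂haarG)

/-- The partial sum `S_n F = ∑_{k<n} F̂(k) w_k` of the Walsh–Fourier series. -/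
def partialSum (n : ℕ) (F : ℕ → G → ℝ) (x : G) : ℝ :=
  ∑ k ∈ Finset.range n, walshCoeff F k * walsh k x

/-- The Fejér mean `σ_n F = (1/n) ∑_{k=1}^n S_k F`. -/
def fejerMean (n : ℕ) (F : ℕ → G → ℝ) (x : G) : ℝ :=
  (1 / (n : ℝ)) * ∑ k ∈ Finset.Icc 1 n, partialSum k F x

/-- The index `α_k^s = 2^s + 2^0 + 2^1 + ⋯ + 2^k`. -/
def alpha (s k : ℕ) : ℕ := 2 ^ s + ∑ j ∈ Finset.range (k + 1), 2 ^ j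

/-- The restricted weighted maximal operator
`sup_s sup_{0 ≤ k ≤ [s^{1/n}] - 1} |σ_{α_k^s} F| / log^{2/n} α_k^s`. -/
def restrictedMaximal (n : ℕ) (F : ℕ → G → ℝ) (x : G) : ℝ≥0∞ :=
  ⨆ (s : ℕ) (k : ℕ) (_ : k < ⌊(s : ℝ) ^ (1 / (n : ℝ))⌋₊),
    ENNReal.ofReal (|fejerMean (alpha s k) F x| / Real.log (alpha s k) ^ (2 / (n : ℝ)))

end WalshFejer

end

/-!
For a martingale `F` the partial sum of order `2 ^ s` is `F s`. Hence `α_k^s σ_{α_k^s} F` splits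
into the sum of the first `2 ^ s` partial sums of `F s`, the term `2 ^ (k + 1) F s`, and, up to a
sign, the sum of the first `2 ^ N` partial sums, `N = k + 1`, of the Walsh polynomial `Q` obtained
by shifting the coefficients of `F (s + 1)` by `2 ^ s`. The sum of the first `2 ^ N` partial sums
of a Walsh polynomial of length `2 ^ N` is an explicit combination of the polynomial and its
translates by the unit vectors `e_j`, `j < N`, with weights proportional to `2 ^ j`.

Put `θ = 1 / √2` and let `u m` be the square root of the running maximum of `|F 0|, …, |F m|`.
Taking square roots, `|σ_{α_k^s} F|^{1/2}` is dominated by `θ`-weighted translate sums of `u s`,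
`u N` and `θ ^ (s - N) |Q|^{1/2}`. Writing `u` as the sum of its increments makes the first two
integrable uniformly in `s` and `N`. For the third, `|Q|` is at most the average of `(u (s + 1))²`
over `I_N`; Minkowski's inequality and the Nikolskii-type bound
`‖g‖_{L²(I_N)} ≤ √2 ^ (m - N) ‖g‖_{L¹(I_N)}` for the increments, which depend on `m` coordinates,
leave `u N` plus `θ`-weighted averages of increments. Those can be summed over all `s`, and over `k`
against weights whose square roots are summable in `k`, uniformly in `s`. The logarithmic weights
qualify, since there are `[s^{1/n}]` of them for each `s`, with square roots of size `s^{-1/n}`.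
-/

noncomputable section

namespace WalshFejer

section Haar

instance : z2Measure.IsAddLeftInvariant := by
  unfold z2Measure
  infer_instance

instance : haarG.IsAddLeftInvariant where
  map_add_left_eq_self a := by
    have h := Measure.infinitePi_map_pi (fun _ : ℕ => z2Measure)
      (f := fun j (t : ZMod 2) => a j + t) (fun j => by fun_prop)
    simp only [map_add_left_eq_self] at h
    exact h

theorem mem_dyadicInterval_comm {N : ℕ} {x y : G} :
    y ∈ dyadicInterval N x ↔ x ∈ dyadicInterval N y :=
  forall₂_congr fun _ _ => eq_comm

theorem dyadicInterval_anti (x : G) : Antitone fun N => dyadicInterval N x :=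
  fun _ _ h _ hy i hi => hy i (hi.trans_le h)

theorem dyadicInterval_congr {N : ℕ} {x y : G} (h : y ∈ dyadicInterval N x) :
    dyadicInterval N y = dyadicInterval N x :=
  Set.ext fun _ => forall₂_congr fun i hi => by rw [h i hi]

theorem haarG_dyadicInterval (N : ℕ) (x : G) : haarG (dyadicInterval N x) = (2 ^ N)⁻¹ := by
  have h : dyadicInterval N x = Set.pi (Finset.range N) (fun i => {x i}) := by
    ext y
    simp [dyadicInterval, Set.mem_pi]
  rw [h, haarG, Measure.infinitePi_pi _ (fun i _ => MeasurableSet.singleton _)]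
  simp [z2Measure, ENNReal.inv_pow]

end Haar

section DependsOn

variable {β : Type*} {s : ℕ} {f : G → β}

theorem apply_eq_of_mem_dyadicInterval (hf : DependsOn f (Set.Iio s)) {x y : G}
    (h : y ∈ dyadicInterval s x) : f y = f x :=
  hf h

theorem apply_add_single (hf : DependsOn f (Set.Iio s)) {j : ℕ} (h : s ≤ j) (x : G) :
    f (x + Pi.single j 1) = f x :=
  hf fun i hi => by simp [Pi.single_eq_of_ne (lt_of_lt_of_le hi h).ne]

theorem measurable_domRestrict_dyadicFiltration (s : ℕ) :
    Measurable[dyadicFiltration s] (Set.domRestrict (Set.Iio s) : G → Set.Iio s → ZMod 2) := by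
  refine @measurable_to_countable _ _ _ _ (dyadicFiltration s) _ fun x => ?_
  have h : (Set.domRestrict (Set.Iio s) : G → Set.Iio s → ZMod 2) ⁻¹'
      {Set.domRestrict (Set.Iio s) x} = dyadicInterval s x := by
    ext y
    simp [dyadicInterval, funext_iff]
  exact MeasurableSpace.measurableSet_generateFrom ⟨x, h.symm⟩

theorem measurable_dyadicFiltration_of_dependsOn [MeasurableSpace β]
    (hf : DependsOn f (Set.Iio s)) : Measurable[dyadicFiltration s] f := by
  have : Nonempty β := ⟨f 0⟩
  obtain ⟨g, rfl⟩ := dependsOn_iff_exists_comp.mp hf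
  exact (measurable_of_finite g).comp (measurable_domRestrict_dyadicFiltration s)

theorem measurable_of_dependsOn [MeasurableSpace β] (hf : DependsOn f (Set.Iio s)) :
    Measurable f :=
  (measurable_dyadicFiltration_of_dependsOn hf).mono (dyadicFiltration.le s) le_rfl

theorem mem_iff_of_measurableSet_dyadicFiltration {A : Set G}
    (hA : MeasurableSet[dyadicFiltration s] A) {x y : G} (hxy : y ∈ dyadicInterval s x) :
    y ∈ A ↔ x ∈ A := by
  induction A, hA using MeasurableSpace.generateFrom_induction with
  | hC A hA _ =>
    obtain ⟨z, rfl⟩ := hA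
    exact forall₂_congr fun i hi => by rw [hxy i hi]
  | empty => simp
  | compl A _ ih => simp [ih]
  | iUnion A _ ih => simp [ih]

theorem dependsOn_of_measurable_dyadicFiltration [MeasurableSpace β] [MeasurableSingletonClass β]
    (hf : Measurable[dyadicFiltration s] f) : DependsOn f (Set.Iio s) := fun _ y hxy =>
  (mem_iff_of_measurableSet_dyadicFiltration (hf (MeasurableSet.singleton (f y))) hxy).mpr rfl

end DependsOn

section Walsh

theorem rademacher_add (k : ℕ) (x y : G) :
    rademacher k (x + y) = rademacher k x * rademacher k y := by
  have h : ∀ a b : ZMod 2, (-1 : ℤ) ^ (a + b).val = (-1) ^ a.val * (-1) ^ b.val := by decide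
  simpa [rademacher] using congrArg (Int.cast : ℤ → ℝ) (h (x k) (y k))

theorem walsh_add (k : ℕ) (x y : G) : walsh k (x + y) = walsh k x * walsh k y := by
  simp only [walsh, rademacher_add, mul_pow, Finset.prod_mul_distrib]

theorem walsh_eq_prod {k N : ℕ} (h : k < 2 ^ N) (x : G) :
    walsh k x = ∏ i ∈ Finset.range N, rademacher i x ^ (k.testBit i).toNat := by
  have extend : ∀ {A B : ℕ}, A ≤ B → k < 2 ^ A →
      ∏ i ∈ Finset.range A, rademacher i x ^ (k.testBit i).toNat =
        ∏ i ∈ Finset.range B, rademacher i x ^ (k.testBit i).toNat := by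
    intro A B hAB hA
    refine Finset.prod_subset (Finset.range_mono hAB) fun i _ hi => ?_
    rw [Nat.testBit_lt_two_pow (hA.trans_le (Nat.pow_le_pow_right two_pos (by simpa using hi)))]
    simp
  rcases le_total k N with hN | hN
  · exact extend hN k.lt_two_pow_self
  · exact (extend hN h).symm

theorem walsh_single (k j : ℕ) : walsh k (Pi.single j 1) = if k.testBit j then -1 else 1 := by
  have hr : ∀ i, rademacher i (Pi.single j 1) = if i = j then -1 else 1 := by
    intro i
    by_cases h : i = j
    · subst h
      simp [rademacher, show (1 : ZMod 2).val = 1 from rfl]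
    · simp [rademacher, h]
  have hk : k < 2 ^ (k + j + 1) :=
    k.lt_two_pow_self.trans_le (Nat.pow_le_pow_right two_pos (by omega))
  simp only [walsh_eq_prod hk, hr, ite_pow, one_pow]
  rw [Finset.prod_ite_eq' _ _ (fun i => (-1 : ℝ) ^ (k.testBit i).toNat),
    if_pos (Finset.mem_range.mpr (by omega))]
  cases k.testBit j <;> simp

theorem walsh_two_pow_add {s k : ℕ} (h : k < 2 ^ s) (x : G) :
    walsh (2 ^ s + k) x = rademacher s x * walsh k x := by
  rw [walsh_eq_prod (N := s + 1) (by rw [pow_succ]; omega), walsh_eq_prod h,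
    Finset.prod_range_succ, Nat.testBit_two_pow_add_eq, Nat.testBit_lt_two_pow h, mul_comm]
  congr 1
  · simp
  · refine Finset.prod_congr rfl fun j hj => ?_
    rw [Nat.testBit_two_pow_add_gt (Finset.mem_range.mp hj)]

theorem abs_rademacher (k : ℕ) (x : G) : |rademacher k x| = 1 := by
  simp [rademacher, abs_pow]

theorem abs_walsh (k : ℕ) (x : G) : |walsh k x| = 1 := by
  simp [walsh, Finset.abs_prod, abs_pow, abs_rademacher]

theorem dependsOn_rademacher (k : ℕ) : DependsOn (rademacher k) (Set.Iio (k + 1)) :=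
  fun x y h => by rw [rademacher, rademacher, h k (Nat.lt_succ_self k)]

theorem dependsOn_walsh {k s : ℕ} (hk : k < 2 ^ s) : DependsOn (walsh k) (Set.Iio s) :=
  fun x y h => by
    rw [walsh_eq_prod hk, walsh_eq_prod hk]
    exact Finset.prod_congr rfl fun i hi => by
      rw [rademacher, rademacher, h i (Finset.mem_range.mp hi)]

theorem measurable_walsh (k : ℕ) : Measurable (walsh k) :=
  measurable_of_dependsOn (dependsOn_walsh k.lt_two_pow_self)

theorem integrable_mul_walsh {f : G → ℝ} (hf : Integrable f haarG) (k : ℕ) :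
    Integrable (fun x => f x * walsh k x) haarG :=
  hf.mul_bdd (c := 1) (measurable_walsh k).aestronglyMeasurable
    (Eventually.of_forall fun x => by simp [abs_walsh])

theorem integrable_rademacher_mul {f : G → ℝ} (hf : Integrable f haarG) (k : ℕ) :
    Integrable (fun x => rademacher k x * f x) haarG :=
  hf.bdd_mul (c := 1) (measurable_of_dependsOn (dependsOn_rademacher k)).aestronglyMeasurable
    (Eventually.of_forall fun x => by simp [abs_rademacher])

theorem sum_walsh_two_pow (N : ℕ) (x : G) :
    ∑ k ∈ Finset.range (2 ^ N), walsh k x =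
      (dyadicInterval N 0).indicator (fun _ => 2 ^ N) x := by
  induction N with
  | zero => simp [walsh, dyadicInterval]
  | succ N ih =>
    have hsplit : ∑ k ∈ Finset.range (2 ^ (N + 1)), walsh k x =
        (1 + rademacher N x) * ∑ k ∈ Finset.range (2 ^ N), walsh k x := by
      rw [pow_succ, mul_two, Finset.sum_range_add, add_mul, one_mul, Finset.mul_sum]
      congr 1
      exact Finset.sum_congr rfl fun k hk => walsh_two_pow_add (Finset.mem_range.mp hk) x
    have hmem : x ∈ dyadicInterval (N + 1) 0 ↔ x ∈ dyadicInterval N 0 ∧ x N = 0 :=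
      Nat.forall_lt_succ_right
    have hbit : x N = 0 ∨ x N = 1 := (by decide : ∀ a : ZMod 2, a = 0 ∨ a = 1) (x N)
    rw [hsplit, ih]
    by_cases hx : x ∈ dyadicInterval N 0 <;> rcases hbit with h | h <;>
      simp [Set.indicator, hmem, hx, h, rademacher, show (1 : ZMod 2).val = 1 from rfl, pow_succ]
    ring

theorem sum_integral_mul_walsh {f : G → ℝ} (hf : Integrable f haarG) (N : ℕ) (x : G) :
    ∑ k ∈ Finset.range (2 ^ N), (∫ y, f y * walsh k y ∂haarG) * walsh k x =
      2 ^ N * ∫ y in dyadicInterval N x, f y ∂haarG := by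
  have hmem : ∀ y, x + y ∈ dyadicInterval N 0 ↔ y ∈ dyadicInterval N x := fun y =>
    forall₂_congr fun i _ => by
      rw [Pi.add_apply, Pi.zero_apply, CharTwo.add_eq_zero, eq_comm]
  have hker : ∀ y, ∑ k ∈ Finset.range (2 ^ N), f y * walsh k y * walsh k x =
      (dyadicInterval N x).indicator (fun y => 2 ^ N * f y) y := by
    intro y
    simp only [mul_assoc, ← Finset.mul_sum, mul_comm (walsh _ y), ← walsh_add, sum_walsh_two_pow]
    by_cases hy : y ∈ dyadicInterval N x
    · rw [Set.indicator_of_mem hy, Set.indicator_of_mem ((hmem y).mpr hy), mul_comm]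
    · rw [Set.indicator_of_notMem hy, Set.indicator_of_notMem (hy ∘ (hmem y).mp), mul_zero]
  simp only [← integral_mul_const]
  rw [← integral_finsetSum _ fun k _ => (integrable_mul_walsh hf k).mul_const _]
  simp only [hker]
  rw [integral_indicator (measurableSet_dyadicInterval N x), integral_const_mul]

end Walsh

section DyadicAverage

/-- The conditional expectation of `g` given the first `N` coordinates, for `ℝ≥0∞`-valued `g`. -/
def dyadicAverage (N : ℕ) (g : G → ℝ≥0∞) (x : G) : ℝ≥0∞ :=
  2 ^ N * ∫⁻ y in dyadicInterval N x, g y ∂haarG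

/-- The root mean square of `g` over the dyadic interval `I_N(x)`. -/
def dyadicRMS (N : ℕ) (g : G → ℝ≥0∞) (x : G) : ℝ≥0∞ :=
  dyadicAverage N (fun y => g y ^ (2 : ℝ)) x ^ (1 / 2 : ℝ)

/-- The number `1 / √2`, the ratio of the geometric sums that bound square roots of Fejér means. -/
def invSqrtTwo : ℝ≥0∞ := 2⁻¹ ^ (1 / 2 : ℝ)

theorem dependsOn_dyadicAverage (N : ℕ) (g : G → ℝ≥0∞) :
    DependsOn (dyadicAverage N g) (Set.Iio N) := fun x y h => by
  rw [dyadicAverage, dyadicAverage, dyadicInterval_congr (x := y) h]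

theorem dyadicAverage_mono (N : ℕ) {g h : G → ℝ≥0∞} (hgh : g ≤ h) (x : G) :
    dyadicAverage N g x ≤ dyadicAverage N h x :=
  mul_le_mul_right (lintegral_mono hgh) _

theorem dyadicAverage_const (N : ℕ) (a : ℝ≥0∞) (x : G) : dyadicAverage N (fun _ => a) x = a := by
  rw [dyadicAverage, setLIntegral_const, haarG_dyadicInterval, mul_left_comm,
    ENNReal.mul_inv_cancel (by simp) (by simp), mul_one]

theorem dyadicAverage_congr {N : ℕ} {g h : G → ℝ≥0∞} {x : G}
    (hgh : ∀ y ∈ dyadicInterval N x, g y = h y) : dyadicAverage N g x = dyadicAverage N h x := by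
  rw [dyadicAverage, dyadicAverage, setLIntegral_congr_fun (measurableSet_dyadicInterval N x) hgh]

theorem dyadicAverage_of_dependsOn {N : ℕ} {g : G → ℝ≥0∞} (hg : DependsOn g (Set.Iio N)) :
    dyadicAverage N g = g := by
  funext x
  rw [dyadicAverage_congr fun y hy => apply_eq_of_mem_dyadicInterval hg hy, dyadicAverage_const]

theorem lintegral_dyadicAverage (N : ℕ) {g : G → ℝ≥0∞} (hg : Measurable g) :
    ∫⁻ x, dyadicAverage N g x ∂haarG = ∫⁻ x, g x ∂haarG := by
  have hset : MeasurableSet {p : G × G | p.2 ∈ dyadicInterval N p.1} := by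
    have hinter : {p : G × G | p.2 ∈ dyadicInterval N p.1} =
        ⋂ i, ⋂ _ : i < N, {p : G × G | p.2 i = p.1 i} := by
      ext p
      simp [dyadicInterval]
    rw [hinter]
    exact MeasurableSet.iInter fun i => MeasurableSet.iInter fun _ =>
      measurableSet_eq_fun (by fun_prop) (by fun_prop)
  have hmeas : Measurable fun p : G × G =>
      {p : G × G | p.2 ∈ dyadicInterval N p.1}.indicator (fun p => g p.2) p :=
    (hg.comp measurable_snd).indicator hset
  have hswap : ∀ x y, (dyadicInterval N x).indicator g y =
      (dyadicInterval N y).indicator (fun _ => g y) x := fun _ _ =>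
    Set.indicator_eq_indicator mem_dyadicInterval_comm rfl
  calc ∫⁻ x, dyadicAverage N g x ∂haarG
      = 2 ^ N * ∫⁻ x, ∫⁻ y, (dyadicInterval N x).indicator g y ∂haarG ∂haarG := by
        simp only [dyadicAverage, lintegral_indicator (measurableSet_dyadicInterval N _)]
        exact lintegral_const_mul' _ _ (by simp)
    _ = 2 ^ N * ∫⁻ y, ∫⁻ x, (dyadicInterval N x).indicator g y ∂haarG ∂haarG := by
        rw [lintegral_lintegral_swap hmeas.aemeasurable]
    _ = ∫⁻ y, dyadicAverage N (fun _ => g y) y ∂haarG := by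
        simp only [hswap, dyadicAverage, lintegral_indicator (measurableSet_dyadicInterval N _)]
        exact (lintegral_const_mul' _ _ (by simp)).symm
    _ = ∫⁻ y, g y ∂haarG := by simp only [dyadicAverage_const]

theorem le_two_pow_mul_dyadicAverage {N k : ℕ} (hNk : N ≤ k) {g : G → ℝ≥0∞}
    (hg : DependsOn g (Set.Iio k)) {x y : G} (hy : y ∈ dyadicInterval N x) :
    g y ≤ 2 ^ (k - N) * dyadicAverage N g x := by
  calc g y = 2 ^ k * ∫⁻ z in dyadicInterval k y, g z ∂haarG :=
        (congrFun (dyadicAverage_of_dependsOn hg) y).symm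
    _ ≤ 2 ^ k * ∫⁻ z in dyadicInterval N x, g z ∂haarG := by
        gcongr
        exact (dyadicInterval_anti y hNk).trans_eq (dyadicInterval_congr hy)
    _ = 2 ^ (k - N) * dyadicAverage N g x := by
        rw [dyadicAverage, ← mul_assoc, ← pow_add, Nat.sub_add_cancel hNk]

theorem dyadicAverage_sq_le {N k : ℕ} (hNk : N ≤ k) {g : G → ℝ≥0∞}
    (hg : DependsOn g (Set.Iio k)) (x : G) :
    dyadicAverage N (fun y => g y ^ (2 : ℝ)) x ≤ 2 ^ (k - N) * dyadicAverage N g x ^ (2 : ℝ) := by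
  have hint : ∫⁻ y in dyadicInterval N x, g y ^ (2 : ℝ) ∂haarG ≤
      ∫⁻ y in dyadicInterval N x, 2 ^ (k - N) * dyadicAverage N g x * g y ∂haarG :=
    setLIntegral_mono' (measurableSet_dyadicInterval N x) fun y hy => by
      rw [ENNReal.rpow_two, sq]
      gcongr
      exact le_two_pow_mul_dyadicAverage hNk hg hy
  rw [lintegral_const_mul _ (measurable_of_dependsOn hg)] at hint
  calc 2 ^ N * ∫⁻ y in dyadicInterval N x, g y ^ (2 : ℝ) ∂haarG
      ≤ 2 ^ N * (2 ^ (k - N) * dyadicAverage N g x * ∫⁻ y in dyadicInterval N x, g y ∂haarG) := by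
        gcongr
    _ = 2 ^ (k - N) * dyadicAverage N g x ^ (2 : ℝ) := by
        rw [ENNReal.rpow_two, dyadicAverage]
        ring

theorem inv_invSqrtTwo : invSqrtTwo⁻¹ = 2 ^ (1 / 2 : ℝ) := by
  rw [invSqrtTwo, ENNReal.inv_rpow, inv_inv]

theorem dyadicRMS_le {N k : ℕ} (hNk : N ≤ k) {g : G → ℝ≥0∞} (hg : DependsOn g (Set.Iio k))
    (x : G) : dyadicRMS N g x ≤ invSqrtTwo⁻¹ ^ (k - N) * dyadicAverage N g x := by
  calc dyadicRMS N g x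
      ≤ (2 ^ (k - N) * dyadicAverage N g x ^ (2 : ℝ)) ^ (1 / 2 : ℝ) :=
        ENNReal.rpow_le_rpow (dyadicAverage_sq_le hNk hg x) (by norm_num)
    _ = invSqrtTwo⁻¹ ^ (k - N) * dyadicAverage N g x := by
        rw [ENNReal.mul_rpow_of_nonneg _ _ (by norm_num), ← ENNReal.rpow_mul, inv_invSqrtTwo,
          ← ENNReal.rpow_natCast, ← ENNReal.rpow_natCast, ← ENNReal.rpow_mul, ← ENNReal.rpow_mul,
          mul_comm (1 / 2 : ℝ)]
        norm_num

theorem dyadicRMS_of_dependsOn {N : ℕ} {g : G → ℝ≥0∞} (hg : DependsOn g (Set.Iio N)) (x : G) :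
    dyadicRMS N g x = g x := by
  have hsq : DependsOn (fun y => g y ^ (2 : ℝ)) (Set.Iio N) := fun _ _ h => by simp only [hg h]
  rw [dyadicRMS, dyadicAverage_of_dependsOn hsq, ← ENNReal.rpow_mul]
  norm_num

theorem dyadicRMS_add_le (N : ℕ) {g h : G → ℝ≥0∞} (hg : Measurable g) (hh : Measurable h)
    (x : G) : dyadicRMS N (g + h) x ≤ dyadicRMS N g x + dyadicRMS N h x := by
  simp only [dyadicRMS, dyadicAverage, ENNReal.mul_rpow_of_nonneg _ _ one_half_pos.le, ← mul_add]
  gcongr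
  exact ENNReal.lintegral_Lp_add_le hg.aemeasurable hh.aemeasurable one_le_two

theorem dyadicRMS_sum_le (N : ℕ) {ι : Type*} (S : Finset ι) {g : ι → G → ℝ≥0∞}
    (hg : ∀ i, Measurable (g i)) (x : G) :
    dyadicRMS N (∑ i ∈ S, g i) x ≤ ∑ i ∈ S, dyadicRMS N (g i) x :=
  Finset.le_sum_of_subadditive_on_pred (fun h => dyadicRMS N h x) Measurable
    (by simp [dyadicRMS, dyadicAverage]) (fun _ _ hf hh => dyadicRMS_add_le N hf hh x)
    (fun _ _ hf hh => hf.add hh) g fun i _ => hg i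

end DyadicAverage

section TranslateSum

/-- The sum of `g` and its translates by the `j`-th unit vectors, `j < N`, with geometric weights
`q ^ (N - j)`. For `q = 1 / 2` it majorizes the sum of the first `2 ^ N` partial sums of a Walsh
polynomial, and for `q = 1 / √2` the square root of that majorant. -/
def translateSum (q : ℝ≥0∞) (N : ℕ) (g : G → ℝ≥0∞) (x : G) : ℝ≥0∞ :=
  g x + ∑ j ∈ Finset.range N, q ^ (N - j) * g (x + Pi.single j 1)

variable {q : ℝ≥0∞} {N : ℕ} {g : G → ℝ≥0∞}

theorem le_translateSum (q : ℝ≥0∞) (N : ℕ) (g : G → ℝ≥0∞) : g ≤ translateSum q N g :=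
  fun _ => le_self_add

theorem translateSum_mono (q : ℝ≥0∞) (N : ℕ) {g h : G → ℝ≥0∞} (hgh : g ≤ h) :
    translateSum q N g ≤ translateSum q N h := fun x => by
  simp only [translateSum]
  gcongr
  exacts [hgh _, hgh _]

theorem translateSum_add (q : ℝ≥0∞) (N : ℕ) (g h : G → ℝ≥0∞) :
    translateSum q N (g + h) = translateSum q N g + translateSum q N h := by
  funext x
  simp only [translateSum, Pi.add_apply, mul_add, Finset.sum_add_distrib]
  ring

theorem translateSum_const_mul (q : ℝ≥0∞) (N : ℕ) (a : ℝ≥0∞) (g : G → ℝ≥0∞) (x : G) :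
    translateSum q N (fun y => a * g y) x = a * translateSum q N g x := by
  simp only [translateSum, mul_add, Finset.mul_sum, mul_left_comm a]

theorem measurable_translateSum (q : ℝ≥0∞) (N : ℕ) (hg : Measurable g) :
    Measurable (translateSum q N g) := by
  unfold translateSum
  fun_prop

theorem translateSum_rpow_le (q : ℝ≥0∞) (N : ℕ) (g : G → ℝ≥0∞) {r : ℝ} (hr₀ : 0 < r)
    (hr₁ : r ≤ 1) (x : G) :
    translateSum q N g x ^ r ≤ translateSum (q ^ r) N (fun y => g y ^ r) x := by
  refine (ENNReal.rpow_add_le_add_rpow _ _ hr₀.le hr₁).trans ?_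
  refine add_le_add le_rfl <| (Finset.le_sum_of_subadditive (· ^ r)
    (ENNReal.zero_rpow_of_pos hr₀).le
    (fun a b => ENNReal.rpow_add_le_add_rpow a b hr₀.le hr₁) _ _).trans_eq ?_
  refine Finset.sum_congr rfl fun j _ => ?_
  rw [ENNReal.mul_rpow_of_nonneg _ _ hr₀.le, ← ENNReal.rpow_natCast, ← ENNReal.rpow_mul,
    mul_comm (_ : ℝ) r, ENNReal.rpow_mul, ENNReal.rpow_natCast]

theorem one_add_sum_pow_sub_le (q : ℝ≥0∞) (N : ℕ) :
    1 + ∑ j ∈ Finset.range N, q ^ (N - j) ≤ (1 - q)⁻¹ := by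
  calc 1 + ∑ j ∈ Finset.range N, q ^ (N - j) = ∑ i ∈ Finset.range (N + 1), q ^ i := by
        rw [Finset.sum_range_succ', ← Finset.sum_range_reflect, add_comm, pow_zero]
        congr 1
        exact Finset.sum_congr rfl fun j hj => by
          rw [Finset.mem_range] at hj
          congr 1
          omega
    _ ≤ ∑' i, q ^ i := ENNReal.sum_le_tsum _
    _ = (1 - q)⁻¹ := ENNReal.tsum_geometric q

theorem lintegral_translateSum_le (q : ℝ≥0∞) (N : ℕ) (hg : Measurable g) :
    ∫⁻ x, translateSum q N g x ∂haarG ≤ (1 - q)⁻¹ * ∫⁻ x, g x ∂haarG := by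
  have htranslate : ∀ j ∈ Finset.range N, ∫⁻ x, q ^ (N - j) * g (x + Pi.single j 1) ∂haarG =
      q ^ (N - j) * ∫⁻ x, g x ∂haarG := fun j _ => by
    rw [lintegral_const_mul _ (by fun_prop), lintegral_add_right_eq_self]
  calc ∫⁻ x, translateSum q N g x ∂haarG
      = (1 + ∑ j ∈ Finset.range N, q ^ (N - j)) * ∫⁻ x, g x ∂haarG := by
        simp only [translateSum]
        rw [lintegral_add_left hg, lintegral_finsetSum _ fun j _ => by fun_prop,
          Finset.sum_congr rfl htranslate, ← Finset.sum_mul, add_mul, one_mul]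
    _ ≤ (1 - q)⁻¹ * ∫⁻ x, g x ∂haarG := by
        gcongr
        exact one_add_sum_pow_sub_le q N

end TranslateSum

section Increments

/-- The increment `u_{m+1} - u_m` of a monotone sequence of functions. -/
def increment (u : ℕ → G → ℝ≥0∞) (m : ℕ) (x : G) : ℝ≥0∞ := u (m + 1) x - u m x

/-- The geometrically weighted sum of averages over `I_N(x)` that dominates the growth of the root
mean square of `u_{s+1}` over `I_N(x)` beyond `u_N(x)`. -/
def averagedIncrements (u : ℕ → G → ℝ≥0∞) (s N : ℕ) (x : G) : ℝ≥0∞ :=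
  ∑ m ∈ Finset.range (s + 1), invSqrtTwo ^ (s - m) * dyadicAverage N (increment u m) x

variable {u : ℕ → G → ℝ≥0∞}

theorem dependsOn_increment (hd : ∀ m, DependsOn (u m) (Set.Iio m)) (m : ℕ) :
    DependsOn (increment u m) (Set.Iio (m + 1)) := fun x y h => by
  rw [increment, increment, hd (m + 1) h, hd m fun i hi => h i (Nat.lt_succ_of_lt hi)]

theorem add_sum_increment (hu : Monotone u) {j s : ℕ} (h : j ≤ s) (x : G) :
    u j x + ∑ m ∈ Finset.Ico j s, increment u m x = u s x := by
  induction s, h using Nat.le_induction with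
  | base => simp
  | succ s h ih =>
    rw [Finset.sum_Ico_succ_top h, ← add_assoc, ih]
    exact add_tsub_cancel_of_le (hu s.le_succ x)

theorem tsum_increment_le (hu : Monotone u) (x : G) : ∑' m, increment u m x ≤ ⨆ m, u m x := by
  refine ENNReal.tsum_le_of_sum_range_le fun s => le_iSup_of_le s ?_
  rw [← add_sum_increment hu s.zero_le x, Finset.range_eq_Ico]
  exact le_add_self

theorem tsum_lintegral_increment_le (hu : Monotone u) (hd : ∀ m, DependsOn (u m) (Set.Iio m)) :
    ∑' m, ∫⁻ x, increment u m x ∂haarG ≤ ∫⁻ x, ⨆ m, u m x ∂haarG := by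
  rw [← lintegral_tsum fun m => (measurable_of_dependsOn (dependsOn_increment hd m)).aemeasurable]
  exact lintegral_mono (tsum_increment_le hu)

theorem translateSum_le_iSup_add_tsum (hu : Monotone u) (hd : ∀ m, DependsOn (u m) (Set.Iio m))
    {q : ℝ≥0∞} (hq : q ≤ 1) (s : ℕ) (x : G) :
    translateSum q s (u s) x ≤
      (1 - q)⁻¹ * (⨆ m, u m x) + ∑' m, translateSum q (m + 1) (increment u m) x := by
  have hsplit : ∀ j ∈ Finset.range s, q ^ (s - j) * u s (x + Pi.single j 1) ≤
      q ^ (s - j) * (⨆ m, u m x) +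
        ∑ m ∈ Finset.Ico j s, q ^ (m + 1 - j) * increment u m (x + Pi.single j 1) := by
    intro j hj
    rw [← add_sum_increment hu (Finset.mem_range.mp hj).le, apply_add_single (hd j) le_rfl,
      mul_add, Finset.mul_sum]
    refine add_le_add ?_ (Finset.sum_le_sum fun m hm => ?_)
    · gcongr
      exact le_iSup (fun m => u m x) j
    · have hm := Finset.mem_Ico.mp hm
      gcongr ?_ * _
      exact pow_le_pow_right_of_le_one' hq (by omega)
  calc translateSum q s (u s) x
      ≤ (⨆ m, u m x) + ∑ j ∈ Finset.range s, (q ^ (s - j) * (⨆ m, u m x) +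
          ∑ m ∈ Finset.Ico j s, q ^ (m + 1 - j) * increment u m (x + Pi.single j 1)) :=
        add_le_add (le_iSup (fun m => u m x) s) (Finset.sum_le_sum hsplit)
    _ = (1 + ∑ j ∈ Finset.range s, q ^ (s - j)) * (⨆ m, u m x) + ∑ m ∈ Finset.range s,
          ∑ j ∈ Finset.range (m + 1), q ^ (m + 1 - j) * increment u m (x + Pi.single j 1) := by
        simp only [Finset.range_eq_Ico]
        rw [Finset.sum_add_distrib, ← Finset.sum_mul, add_mul, one_mul, ← add_assoc,
          Finset.sum_Ico_Ico_comm]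
    _ ≤ (1 - q)⁻¹ * (⨆ m, u m x) +
          ∑ m ∈ Finset.range s, translateSum q (m + 1) (increment u m) x := by
        gcongr
        · exact one_add_sum_pow_sub_le q s
        · exact le_add_self
    _ ≤ _ := by
        gcongr
        exact ENNReal.sum_le_tsum _

theorem dyadicRMS_le_add_sum_increment (hu : Monotone u)
    (hd : ∀ m, DependsOn (u m) (Set.Iio m)) {s N : ℕ} (hN : N ≤ s) (x : G) :
    dyadicRMS N (u s) x ≤ u N x + ∑ m ∈ Finset.Ico N s,
      invSqrtTwo⁻¹ ^ (m + 1 - N) * dyadicAverage N (increment u m) x := by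
  have hmeas : ∀ m, Measurable (increment u m) := fun m =>
    measurable_of_dependsOn (dependsOn_increment hd m)
  have hsum : u s = u N + ∑ m ∈ Finset.Ico N s, increment u m := by
    funext x
    simp [← add_sum_increment hu hN x]
  rw [hsum]
  refine (dyadicRMS_add_le N (measurable_of_dependsOn (hd N)) (by fun_prop) x).trans
    (add_le_add ?_ ?_)
  · exact (dyadicRMS_of_dependsOn (hd N) x).le
  · refine (dyadicRMS_sum_le N _ hmeas x).trans (Finset.sum_le_sum fun m hm => ?_)
    have := Finset.mem_Ico.mp hm
    exact dyadicRMS_le (by omega) (dependsOn_increment hd m) x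

theorem invSqrtTwo_lt_one : invSqrtTwo < 1 :=
  ENNReal.rpow_lt_one (by simp) one_half_pos

theorem invSqrtTwo_pow_mul_inv_pow_le {s m N : ℕ} (hN : N ≤ m) (hm : m ≤ s) :
    invSqrtTwo ^ (s - N) * invSqrtTwo⁻¹ ^ (m + 1 - N) ≤ 2 * invSqrtTwo ^ (s - m) := by
  have hpos : invSqrtTwo ≠ 0 := by simp [invSqrtTwo]
  have htop : invSqrtTwo ≠ ∞ := by simp [invSqrtTwo]
  have hinv : invSqrtTwo⁻¹ ≤ 2 := by
    simpa [inv_invSqrtTwo] using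
      ENNReal.rpow_le_rpow_of_exponent_le one_le_two (show (1 / 2 : ℝ) ≤ 1 by norm_num)
  calc invSqrtTwo ^ (s - N) * invSqrtTwo⁻¹ ^ (m + 1 - N)
      = (invSqrtTwo * invSqrtTwo⁻¹) ^ (m - N) * (invSqrtTwo⁻¹ * invSqrtTwo ^ (s - m)) := by
        rw [show s - N = (m - N) + (s - m) by omega, show m + 1 - N = (m - N) + 1 by omega]
        ring
    _ ≤ 2 * invSqrtTwo ^ (s - m) := by
        rw [ENNReal.mul_inv_cancel hpos htop, one_pow, one_mul]
        gcongr

theorem invSqrtTwo_pow_mul_dyadicRMS_le (hu : Monotone u)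
    (hd : ∀ m, DependsOn (u m) (Set.Iio m)) {s N : ℕ} (hN : N ≤ s) (x : G) :
    invSqrtTwo ^ (s - N) * dyadicRMS N (u (s + 1)) x ≤
      u N x + 2 * averagedIncrements u s N x := by
  calc invSqrtTwo ^ (s - N) * dyadicRMS N (u (s + 1)) x
      ≤ invSqrtTwo ^ (s - N) * (u N x + ∑ m ∈ Finset.Ico N (s + 1),
          invSqrtTwo⁻¹ ^ (m + 1 - N) * dyadicAverage N (increment u m) x) := by
        gcongr
        exact dyadicRMS_le_add_sum_increment hu hd (by omega) x
    _ ≤ u N x + ∑ m ∈ Finset.Ico N (s + 1),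
          2 * (invSqrtTwo ^ (s - m) * dyadicAverage N (increment u m) x) := by
        rw [mul_add, Finset.mul_sum]
        refine add_le_add (mul_le_of_le_one_left' (pow_le_one' invSqrtTwo_lt_one.le _))
          (Finset.sum_le_sum fun m hm => ?_)
        have hm := Finset.mem_Ico.mp hm
        rw [← mul_assoc, ← mul_assoc]
        gcongr ?_ * _
        exact invSqrtTwo_pow_mul_inv_pow_le (by omega) (by omega)
    _ ≤ u N x + 2 * averagedIncrements u s N x := by
        rw [← Finset.mul_sum, averagedIncrements]
        gcongr
        exact fun m hm => Finset.mem_range.mpr (Finset.mem_Ico.mp hm).2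

end Increments

section Martingale

variable {F : ℕ → G → ℝ}

theorem dependsOn_of_martingale (hF : Martingale F dyadicFiltration haarG) (s : ℕ) :
    DependsOn (F s) (Set.Iio s) :=
  dependsOn_of_measurable_dyadicFiltration (hF.stronglyAdapted s).measurable

theorem walshCoeff_eq_integral (hF : Martingale F dyadicFiltration haarG) {s k : ℕ}
    (hk : k < 2 ^ s) : walshCoeff F k = ∫ x, F s x * walsh k x ∂haarG := by
  have hw : StronglyMeasurable[dyadicFiltration s] (walsh k) :=
    (measurable_dyadicFiltration_of_dependsOn (dependsOn_walsh hk)).stronglyMeasurable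
  have hconst : ∀ m, s ≤ m → ∫ x, F m x * walsh k x ∂haarG = ∫ x, F s x * walsh k x ∂haarG := by
    intro m hm
    have hpull : haarG[F m * walsh k | dyadicFiltration s] =ᵐ[haarG]
        haarG[F m | dyadicFiltration s] * walsh k :=
      condExp_mul_of_stronglyMeasurable_right hw (integrable_mul_walsh (hF.integrable m) k)
        (hF.integrable m)
    calc ∫ x, F m x * walsh k x ∂haarG
        = ∫ x, (haarG[F m * walsh k | dyadicFiltration s]) x ∂haarG :=
          (integral_condExp (dyadicFiltration.le s)).symm
      _ = ∫ x, F s x * walsh k x ∂haarG := by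
          refine integral_congr_ae (hpull.trans ?_)
          filter_upwards [hF.condExp_ae_eq hm] with x hx
          rw [Pi.mul_apply, hx]
  exact (tendsto_atTop_of_eventually_const hconst).limUnder_eq

theorem partialSum_two_pow (hF : Martingale F dyadicFiltration haarG) (s : ℕ) (x : G) :
    partialSum (2 ^ s) F x = F s x := by
  have havg : 2 ^ s * ∫ y in dyadicInterval s x, F s y ∂haarG = F s x := by
    rw [setIntegral_congr_fun (measurableSet_dyadicInterval s x) fun y hy =>
      apply_eq_of_mem_dyadicInterval (dependsOn_of_martingale hF s) hy]
    simp [measureReal_def, haarG_dyadicInterval]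
  rw [← havg, ← sum_integral_mul_walsh (hF.integrable s)]
  exact Finset.sum_congr rfl fun k hk => by
    rw [walshCoeff_eq_integral hF (Finset.mem_range.mp hk)]

end Martingale

section FejerSums

/-- The Walsh polynomial of length `n` with coefficients `c`. -/
def walshPoly (c : ℕ → ℝ) (n : ℕ) (x : G) : ℝ := ∑ k ∈ Finset.range n, c k * walsh k x

/-- The coefficients `k ↦ F̂(2 ^ s + k)` of the part of the Walsh series of `F` beyond `2 ^ s`. -/
def shiftedCoeff (F : ℕ → G → ℝ) (s k : ℕ) : ℝ := walshCoeff F (2 ^ s + k)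

theorem sum_two_pow_mul_testBit {R : Type*} [CommRing R] (k N : ℕ) :
    ∑ j ∈ Finset.range N, (2 : R) ^ j * (if k.testBit j then -1 else 1) =
      2 ^ N - 1 - 2 * (k % 2 ^ N : ℕ) := by
  induction N with
  | zero => simp [Nat.mod_one]
  | succ N ih =>
    rw [Finset.sum_range_succ, ih, Nat.mod_pow_succ, Nat.testBit_eq_decide_div_mod_eq]
    rcases Nat.mod_two_eq_zero_or_one (k / 2 ^ N) with h | h <;> simp [h] <;> ring

theorem sum_range_sum_range {R : Type*} [CommRing R] (a : ℕ → R) (M : ℕ) :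
    ∑ i ∈ Finset.range M, ∑ k ∈ Finset.range i, a k =
      ∑ k ∈ Finset.range M, ((M : R) - 1 - k) * a k := by
  induction M with
  | zero => simp
  | succ M ih =>
    rw [Finset.sum_range_succ, ih, ← Finset.sum_add_distrib, Finset.sum_range_succ]
    push_cast
    rw [add_sub_cancel_right, sub_self, zero_mul, add_zero]
    exact Finset.sum_congr rfl fun k _ => by ring

theorem sum_walshPoly_two_pow (c : ℕ → ℝ) (N : ℕ) (x : G) :
    ∑ i ∈ Finset.range (2 ^ N), walshPoly c i x =
      ((2 ^ N - 1) * walshPoly c (2 ^ N) x +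
        ∑ j ∈ Finset.range N, 2 ^ j * walshPoly c (2 ^ N) (x + Pi.single j 1)) / 2 := by
  have htranslates : ∀ k ∈ Finset.range (2 ^ N),
      ∑ j ∈ Finset.range N, 2 ^ j * (c k * walsh k (x + Pi.single j 1)) =
        (2 ^ N - 1 - 2 * k) * (c k * walsh k x) := by
    intro k hk
    rw [← Nat.mod_eq_of_lt (Finset.mem_range.mp hk), ← sum_two_pow_mul_testBit,
      Nat.mod_eq_of_lt (Finset.mem_range.mp hk), Finset.sum_mul]
    exact Finset.sum_congr rfl fun j _ => by rw [walsh_add, walsh_single]; ring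
  simp only [walshPoly, sum_range_sum_range, Finset.mul_sum]
  rw [Finset.sum_comm, Finset.sum_congr rfl htranslates, ← Finset.sum_add_distrib, Finset.sum_div]
  exact Finset.sum_congr rfl fun k _ => by push_cast; ring

theorem enorm_two_pow (j : ℕ) : ‖(2 : ℝ) ^ j‖ₑ = 2 ^ j := by
  rw [Real.enorm_of_nonneg (by positivity), ENNReal.ofReal_pow two_pos.le, ENNReal.ofReal_ofNat]

theorem two_pow_mul_inv_two_pow {j N : ℕ} (h : j ≤ N) :
    (2 : ℝ≥0∞) ^ N * 2⁻¹ ^ (N - j) = 2 ^ j := by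
  rw [← Nat.add_sub_of_le h, Nat.add_sub_cancel_left, pow_add, mul_assoc, ← mul_pow,
    ENNReal.mul_inv_cancel two_ne_zero ENNReal.ofNat_ne_top, one_pow, mul_one]

theorem enorm_sum_walshPoly_le (c : ℕ → ℝ) (N : ℕ) (x : G) :
    ‖∑ i ∈ Finset.range (2 ^ N), walshPoly c i x‖ₑ ≤
      2 ^ N * translateSum 2⁻¹ N (fun y => ‖walshPoly c (2 ^ N) y‖ₑ) x := by
  have hhalf : ∀ a : ℝ, ‖a / 2‖ₑ ≤ ‖a‖ₑ := fun a => by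
    rw [enorm_le_iff_norm_le, norm_div, Real.norm_two]
    exact half_le_self (norm_nonneg a)
  have hcoeff : ‖(2 : ℝ) ^ N - 1‖ₑ ≤ 2 ^ N := by
    rw [← enorm_two_pow, Real.enorm_of_nonneg (sub_nonneg.mpr (one_le_pow₀ one_le_two)),
      Real.enorm_of_nonneg (by positivity)]
    exact ENNReal.ofReal_le_ofReal (sub_le_self _ zero_le_one)
  have hweight : ∀ j ∈ Finset.range N, ‖(2 : ℝ) ^ j‖ₑ = 2 ^ N * 2⁻¹ ^ (N - j) := fun j hj => by
    rw [enorm_two_pow, two_pow_mul_inv_two_pow (Finset.mem_range.mp hj).le]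
  rw [sum_walshPoly_two_pow, translateSum, mul_add, Finset.mul_sum]
  refine (hhalf _).trans ((enorm_add_le _ _).trans (add_le_add ?_ ?_))
  · rw [enorm_mul]
    gcongr
  · refine (enorm_sum_le _ _).trans (Finset.sum_le_sum fun j hj => ?_)
    rw [enorm_mul, hweight j hj, mul_assoc]

variable {F : ℕ → G → ℝ}

theorem partialSum_two_pow_add (hF : Martingale F dyadicFiltration haarG) {s i : ℕ}
    (hi : i ≤ 2 ^ s) (x : G) : partialSum (2 ^ s + i) F x =
      F s x + rademacher s x * walshPoly (shiftedCoeff F s) i x := by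
  rw [← partialSum_two_pow hF, partialSum, Finset.sum_range_add, walshPoly, Finset.mul_sum]
  congr 1
  refine Finset.sum_congr rfl fun k hk => ?_
  rw [walsh_two_pow_add ((Finset.mem_range.mp hk).trans_le hi), shiftedCoeff]
  ring

theorem enorm_rademacher (s : ℕ) (x : G) : ‖rademacher s x‖ₑ = 1 := by
  rw [Real.enorm_eq_ofReal_abs, abs_rademacher, ENNReal.ofReal_one]

theorem enorm_walshPoly_shiftedCoeff_le (hF : Martingale F dyadicFiltration haarG) {s N : ℕ}
    (hN : N ≤ s) (x : G) : ‖walshPoly (shiftedCoeff F s) (2 ^ N) x‖ₑ ≤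
      dyadicAverage N (fun y => ‖F (s + 1) y‖ₑ) x := by
  have hcoeff : ∀ k ∈ Finset.range (2 ^ N), shiftedCoeff F s k =
      ∫ y, rademacher s y * F (s + 1) y * walsh k y ∂haarG := by
    intro k hk
    have hk : k < 2 ^ s :=
      (Finset.mem_range.mp hk).trans_le (Nat.pow_le_pow_right two_pos hN)
    rw [shiftedCoeff, walshCoeff_eq_integral hF (s := s + 1) (by rw [pow_succ]; omega)]
    simp only [walsh_two_pow_add hk, mul_left_comm, mul_assoc]
  have hsum : walshPoly (shiftedCoeff F s) (2 ^ N) x =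
      2 ^ N * ∫ y in dyadicInterval N x, rademacher s y * F (s + 1) y ∂haarG := by
    rw [← sum_integral_mul_walsh (integrable_rademacher_mul (hF.integrable _) s)]
    exact Finset.sum_congr rfl fun k hk => by rw [hcoeff k hk]
  rw [hsum, enorm_mul, enorm_two_pow, dyadicAverage]
  gcongr
  refine (enorm_integral_le_lintegral_enorm _).trans_eq ?_
  simp only [enorm_mul, enorm_rademacher, one_mul]

theorem alpha_add_one (s k : ℕ) : alpha s k + 1 = 2 ^ s + 2 ^ (k + 1) := by
  rw [alpha, add_assoc, Nat.geomSum_eq le_rfl, Nat.div_one,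
    Nat.sub_add_cancel (Nat.one_le_two_pow)]

theorem alpha_mul_fejerMean (hF : Martingale F dyadicFiltration haarG) {s k : ℕ} (hk : k < s)
    (x : G) : alpha s k * fejerMean (alpha s k) F x =
      ∑ i ∈ Finset.range (2 ^ s), walshPoly (walshCoeff F) i x + 2 ^ (k + 1) * F s x +
        rademacher s x * ∑ i ∈ Finset.range (2 ^ (k + 1)), walshPoly (shiftedCoeff F s) i x := by
  have hzero : partialSum 0 F x = 0 := by simp [partialSum]
  have hrange : ∑ i ∈ Finset.Icc 1 (alpha s k), partialSum i F x =
      ∑ i ∈ Finset.range (alpha s k + 1), partialSum i F x := by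
    rw [Finset.sum_range_succ', hzero, add_zero, Finset.range_eq_Ico,
      Finset.sum_Ico_add' (fun i => partialSum i F x), zero_add]
    rfl
  have hpos : (alpha s k : ℝ) ≠ 0 := by
    rw [Nat.cast_ne_zero, alpha]
    positivity
  have htail : ∀ i ∈ Finset.range (2 ^ (k + 1)), partialSum (2 ^ s + i) F x =
      F s x + rademacher s x * walshPoly (shiftedCoeff F s) i x := fun i hi =>
    partialSum_two_pow_add hF
      ((Finset.mem_range.mp hi).le.trans (Nat.pow_le_pow_right two_pos hk)) x
  rw [fejerMean, ← mul_assoc, mul_one_div_cancel hpos, one_mul, hrange, alpha_add_one,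
    Finset.sum_range_add, Finset.sum_congr rfl htail, Finset.sum_add_distrib, ← Finset.mul_sum,
    Finset.sum_const, Finset.card_range, nsmul_eq_mul, ← add_assoc]
  push_cast
  rfl

theorem enorm_fejerMean_alpha_le (hF : Martingale F dyadicFiltration haarG) {s k : ℕ}
    (hk : k < s) (x : G) : ‖fejerMean (alpha s k) F x‖ₑ ≤
      translateSum 2⁻¹ s (fun y => ‖F s y‖ₑ) x + ‖F s x‖ₑ + 2⁻¹ ^ (s - (k + 1)) *
        translateSum 2⁻¹ (k + 1) (fun y => ‖walshPoly (shiftedCoeff F s) (2 ^ (k + 1)) y‖ₑ) x := by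
  have hpartial : ∀ y, ‖walshPoly (walshCoeff F) (2 ^ s) y‖ₑ = ‖F s y‖ₑ := fun y => by
    rw [← partialSum_two_pow hF, walshPoly, partialSum]
  have hweight : (2 : ℝ≥0∞) ^ (k + 1) = 2 ^ s * 2⁻¹ ^ (s - (k + 1)) :=
    (two_pow_mul_inv_two_pow hk).symm
  have hpow : (2 : ℝ≥0∞) ^ s ≤ ‖(alpha s k : ℝ)‖ₑ := by
    rw [← enorm_two_pow, enorm_le_iff_norm_le, Real.norm_of_nonneg (by positivity),
      Real.norm_of_nonneg (by positivity), alpha]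
    exact_mod_cast Nat.le_add_right _ _
  rw [← ENNReal.mul_le_mul_iff_right (a := 2 ^ s) (by simp) (by simp)]
  calc 2 ^ s * ‖fejerMean (alpha s k) F x‖ₑ
      ≤ ‖(alpha s k : ℝ) * fejerMean (alpha s k) F x‖ₑ := by
        rw [enorm_mul]
        gcongr
    _ ≤ ‖∑ i ∈ Finset.range (2 ^ s), walshPoly (walshCoeff F) i x‖ₑ + 2 ^ (k + 1) * ‖F s x‖ₑ +
          ‖∑ i ∈ Finset.range (2 ^ (k + 1)), walshPoly (shiftedCoeff F s) i x‖ₑ := by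
        rw [alpha_mul_fejerMean hF hk]
        refine (enorm_add_le _ _).trans (add_le_add ((enorm_add_le _ _).trans_eq ?_) ?_)
        · rw [enorm_mul, enorm_two_pow]
        · rw [enorm_mul, enorm_rademacher, one_mul]
    _ ≤ 2 ^ s * translateSum 2⁻¹ s (fun y => ‖F s y‖ₑ) x + 2 ^ s * ‖F s x‖ₑ + 2 ^ (k + 1) *
          translateSum 2⁻¹ (k + 1)
            (fun y => ‖walshPoly (shiftedCoeff F s) (2 ^ (k + 1)) y‖ₑ) x := by
        simp only [← hpartial]
        gcongr
        · exact enorm_sum_walshPoly_le _ s x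
        · exact one_le_two
        · exact hk
        · exact enorm_sum_walshPoly_le _ (k + 1) x
    _ = _ := by rw [hweight, mul_add, mul_add, mul_assoc (2 ^ s)]

end FejerSums

section RunningMaximum

/-- The square root of the running maximum `max (|F 0|, …, |F m|)`. -/
def rootRunningMax (F : ℕ → G → ℝ) (m : ℕ) (x : G) : ℝ≥0∞ := ⨆ i ≤ m, ‖F i x‖ₑ ^ (1 / 2 : ℝ)

variable {F : ℕ → G → ℝ}

theorem monotone_rootRunningMax (F : ℕ → G → ℝ) : Monotone (rootRunningMax F) :=
  fun _ _ h _ => biSup_mono fun _ hi => hi.trans h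

theorem enorm_rpow_le_rootRunningMax (F : ℕ → G → ℝ) (m : ℕ) (x : G) :
    ‖F m x‖ₑ ^ (1 / 2 : ℝ) ≤ rootRunningMax F m x :=
  le_iSup₂ (f := fun i _ => ‖F i x‖ₑ ^ (1 / 2 : ℝ)) m le_rfl

theorem enorm_le_rootRunningMax_sq (F : ℕ → G → ℝ) (m : ℕ) (x : G) :
    ‖F m x‖ₑ ≤ rootRunningMax F m x ^ (2 : ℝ) := by
  rw [← ENNReal.rpow_inv_le_iff two_pos, ← one_div]
  exact enorm_rpow_le_rootRunningMax F m x

theorem dependsOn_rootRunningMax (hd : ∀ m, DependsOn (F m) (Set.Iio m)) (m : ℕ) :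
    DependsOn (rootRunningMax F m) (Set.Iio m) := fun x y h => by
  refine iSup_congr fun i => iSup_congr fun hi => ?_
  rw [hd i fun j hj => h j (lt_of_lt_of_le hj hi)]

theorem iSup_rootRunningMax_le (F : ℕ → G → ℝ) (x : G) :
    ⨆ m, rootRunningMax F m x ≤ maximalFunction F x ^ (1 / 2 : ℝ) :=
  iSup_le fun _ => iSup₂_le fun i _ =>
    ENNReal.rpow_le_rpow (le_iSup (fun i => ‖F i x‖ₑ) i) one_half_pos.le

theorem enorm_walshPoly_shiftedCoeff_rpow_le (hF : Martingale F dyadicFiltration haarG) {s N : ℕ}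
    (hN : N ≤ s) (x : G) : ‖walshPoly (shiftedCoeff F s) (2 ^ N) x‖ₑ ^ (1 / 2 : ℝ) ≤
      dyadicRMS N (rootRunningMax F (s + 1)) x :=
  ENNReal.rpow_le_rpow ((enorm_walshPoly_shiftedCoeff_le hF hN x).trans <|
    dyadicAverage_mono N (enorm_le_rootRunningMax_sq F (s + 1)) x) one_half_pos.le

theorem inv_two_pow_mul_rpow_half (n : ℕ) (a : ℝ≥0∞) :
    (2⁻¹ ^ n * a) ^ (1 / 2 : ℝ) = invSqrtTwo ^ n * a ^ (1 / 2 : ℝ) := by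
  rw [ENNReal.mul_rpow_of_nonneg _ _ one_half_pos.le, invSqrtTwo, ← ENNReal.rpow_natCast,
    ← ENNReal.rpow_natCast, ← ENNReal.rpow_mul, ← ENNReal.rpow_mul, mul_comm (n : ℝ)]

theorem translateSum_walshPoly_shiftedCoeff_rpow_le (hF : Martingale F dyadicFiltration haarG)
    {s N : ℕ} (hN : N ≤ s) (x : G) :
    (2⁻¹ ^ (s - N) * translateSum 2⁻¹ N
        (fun y => ‖walshPoly (shiftedCoeff F s) (2 ^ N) y‖ₑ) x) ^ (1 / 2 : ℝ) ≤
      translateSum invSqrtTwo N (rootRunningMax F N) x +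
        2 * translateSum invSqrtTwo N (averagedIncrements (rootRunningMax F) s N) x := by
  have hroot : (fun y => (2⁻¹ ^ (s - N) * ‖walshPoly (shiftedCoeff F s) (2 ^ N) y‖ₑ) ^
        (1 / 2 : ℝ)) ≤
      rootRunningMax F N + fun y => 2 * averagedIncrements (rootRunningMax F) s N y := fun y => by
    simp only [inv_two_pow_mul_rpow_half]
    refine le_trans ?_ (invSqrtTwo_pow_mul_dyadicRMS_le (monotone_rootRunningMax F)
      (dependsOn_rootRunningMax (dependsOn_of_martingale hF)) hN y)
    gcongr
    exact enorm_walshPoly_shiftedCoeff_rpow_le hF hN y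
  rw [← translateSum_const_mul, ← translateSum_const_mul, ← Pi.add_apply, ← translateSum_add]
  exact (translateSum_rpow_le _ N _ one_half_pos one_half_lt_one.le x).trans
    (translateSum_mono _ N hroot x)

theorem enorm_fejerMean_alpha_rpow_le (hF : Martingale F dyadicFiltration haarG) {s k : ℕ}
    (hk : k < s) (x : G) : ‖fejerMean (alpha s k) F x‖ₑ ^ (1 / 2 : ℝ) ≤
      2 * translateSum invSqrtTwo s (rootRunningMax F s) x +
        translateSum invSqrtTwo (k + 1) (rootRunningMax F (k + 1)) x +
        2 * translateSum invSqrtTwo (k + 1)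
          (averagedIncrements (rootRunningMax F) s (k + 1)) x := by
  set u := rootRunningMax F
  have hhead : translateSum 2⁻¹ s (fun y => ‖F s y‖ₑ) x ^ (1 / 2 : ℝ) ≤
      translateSum invSqrtTwo s (u s) x :=
    (translateSum_rpow_le _ s _ one_half_pos one_half_lt_one.le x).trans
      (translateSum_mono _ s (enorm_rpow_le_rootRunningMax F s) x)
  have hmiddle : ‖F s x‖ₑ ^ (1 / 2 : ℝ) ≤ translateSum invSqrtTwo s (u s) x :=
    (enorm_rpow_le_rootRunningMax F s x).trans (le_translateSum _ s _ x)
  calc ‖fejerMean (alpha s k) F x‖ₑ ^ (1 / 2 : ℝ)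
      ≤ _ := ENNReal.rpow_le_rpow (enorm_fejerMean_alpha_le hF hk x) one_half_pos.le
    _ ≤ translateSum invSqrtTwo s (u s) x + translateSum invSqrtTwo s (u s) x +
          (translateSum invSqrtTwo (k + 1) (u (k + 1)) x +
            2 * translateSum invSqrtTwo (k + 1) (averagedIncrements u s (k + 1)) x) := by
        refine (ENNReal.rpow_add_le_add_rpow _ _ one_half_pos.le one_half_lt_one.le).trans
          (add_le_add ?_ (translateSum_walshPoly_shiftedCoeff_rpow_le hF hk x))
        exact (ENNReal.rpow_add_le_add_rpow _ _ one_half_pos.le one_half_lt_one.le).trans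
          (add_le_add hhead hmiddle)
    _ = _ := by ring

end RunningMaximum

section Majorants

/-- A majorant of `translateSum q s (u s)` that does not depend on `s`. -/
def translateMajorant (q : ℝ≥0∞) (u : ℕ → G → ℝ≥0∞) (x : G) : ℝ≥0∞ :=
  (1 - q)⁻¹ * (⨆ m, u m x) + ∑' m, translateSum q (m + 1) (increment u m) x

/-- The sum over all pairs `k < s`, with weights `v s k`, of the translate sums of the averaged
increments; summing, rather than taking suprema, is what makes it integrable. -/
def weightedRemainder (v : ℕ → ℕ → ℝ≥0∞) (u : ℕ → G → ℝ≥0∞) (x : G) : ℝ≥0∞ :=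
  ∑' s, ∑ k ∈ Finset.range s,
    v s k * translateSum invSqrtTwo (k + 1) (averagedIncrements u s (k + 1)) x

variable {u : ℕ → G → ℝ≥0∞}

theorem lintegral_translateMajorant_le (q : ℝ≥0∞) (hu : Monotone u)
    (hd : ∀ m, DependsOn (u m) (Set.Iio m)) :
    ∫⁻ x, translateMajorant q u x ∂haarG ≤ 2 * (1 - q)⁻¹ * ∫⁻ x, ⨆ m, u m x ∂haarG := by
  have hincr : ∀ m, Measurable (increment u m) := fun m =>
    measurable_of_dependsOn (dependsOn_increment hd m)
  have htrans : ∀ m, Measurable (translateSum q (m + 1) (increment u m)) := fun m =>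
    measurable_translateSum q (m + 1) (hincr m)
  have hsup : Measurable fun x => ⨆ m, u m x := .iSup fun m => measurable_of_dependsOn (hd m)
  calc ∫⁻ x, translateMajorant q u x ∂haarG
      = (1 - q)⁻¹ * ∫⁻ x, ⨆ m, u m x ∂haarG +
          ∑' m, ∫⁻ x, translateSum q (m + 1) (increment u m) x ∂haarG := by
        simp only [translateMajorant]
        rw [lintegral_add_left (hsup.const_mul _), lintegral_const_mul _ hsup,
          lintegral_tsum fun m => (htrans m).aemeasurable]
    _ ≤ (1 - q)⁻¹ * ∫⁻ x, ⨆ m, u m x ∂haarG +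
          (1 - q)⁻¹ * ∫⁻ x, ⨆ m, u m x ∂haarG := by
        gcongr
        refine (ENNReal.tsum_le_tsum fun m =>
          lintegral_translateSum_le q (m + 1) (hincr m)).trans ?_
        rw [ENNReal.tsum_mul_left]
        gcongr
        exact tsum_lintegral_increment_le hu hd
    _ = 2 * (1 - q)⁻¹ * ∫⁻ x, ⨆ m, u m x ∂haarG := by ring

theorem tsum_sum_range_pow_sub_mul (q : ℝ≥0∞) (a : ℕ → ℝ≥0∞) :
    ∑' s, ∑ m ∈ Finset.range (s + 1), q ^ (s - m) * a m = (1 - q)⁻¹ * ∑' m, a m := by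
  calc ∑' s, ∑ m ∈ Finset.range (s + 1), q ^ (s - m) * a m
      = ∑' s, ∑' p : Finset.HasAntidiagonal.antidiagonal s, q ^ p.1.2 * a p.1.1 :=
        tsum_congr fun s => by
          rw [Finset.tsum_subtype _ fun p : ℕ × ℕ => q ^ p.2 * a p.1,
            Finset.Nat.sum_antidiagonal_eq_sum_range_succ fun i j => q ^ j * a i]
    _ = ∑' p : ℕ × ℕ, q ^ p.2 * a p.1 := by
        rw [← Finset.HasAntidiagonal.sigmaAntidiagonalEquivProd.tsum_eq, ENNReal.tsum_sigma']
        rfl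
    _ = (1 - q)⁻¹ * ∑' m, a m := by
        rw [ENNReal.tsum_prod', ← ENNReal.tsum_mul_left]
        simp only [ENNReal.tsum_mul_right, ENNReal.tsum_geometric]

theorem measurable_averagedIncrements (u : ℕ → G → ℝ≥0∞) (s N : ℕ) :
    Measurable (averagedIncrements u s N) := by
  have hmeas : ∀ m, Measurable (dyadicAverage N (increment u m)) := fun m =>
    measurable_of_dependsOn (dependsOn_dyadicAverage N _)
  unfold averagedIncrements
  fun_prop

theorem measurable_translateSum_averagedIncrements (u : ℕ → G → ℝ≥0∞) (s k : ℕ) :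
    Measurable (translateSum invSqrtTwo (k + 1) (averagedIncrements u s (k + 1))) :=
  measurable_translateSum _ _ (measurable_averagedIncrements u s _)

theorem measurable_weightedRemainder (v : ℕ → ℕ → ℝ≥0∞) (u : ℕ → G → ℝ≥0∞) :
    Measurable (weightedRemainder v u) := by
  have := measurable_translateSum_averagedIncrements u
  unfold weightedRemainder
  fun_prop

theorem lintegral_averagedIncrements (hd : ∀ m, DependsOn (u m) (Set.Iio m)) (s N : ℕ) :
    ∫⁻ x, averagedIncrements u s N x ∂haarG =
      ∑ m ∈ Finset.range (s + 1), invSqrtTwo ^ (s - m) * ∫⁻ x, increment u m x ∂haarG := by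
  have hmeas : ∀ m, Measurable (dyadicAverage N (increment u m)) := fun m =>
    measurable_of_dependsOn (dependsOn_dyadicAverage N _)
  simp only [averagedIncrements]
  rw [lintegral_finsetSum _ fun m _ => (hmeas m).const_mul _]
  exact Finset.sum_congr rfl fun m _ => by
    rw [lintegral_const_mul _ (hmeas m),
      lintegral_dyadicAverage N (measurable_of_dependsOn (dependsOn_increment hd m))]

theorem lintegral_weightedRemainder_le (hd : ∀ m, DependsOn (u m) (Set.Iio m))
    {v : ℕ → ℕ → ℝ≥0∞} {A : ℝ≥0∞} (hv : ∀ s, ∑ k ∈ Finset.range s, v s k ≤ A) :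
    ∫⁻ x, weightedRemainder v u x ∂haarG ≤
      A * (1 - invSqrtTwo)⁻¹ ^ 2 * ∑' m, ∫⁻ x, increment u m x ∂haarG := by
  have hlevel : ∀ s, ∫⁻ x, ∑ k ∈ Finset.range s,
        v s k * translateSum invSqrtTwo (k + 1) (averagedIncrements u s (k + 1)) x ∂haarG ≤
      A * (1 - invSqrtTwo)⁻¹ *
        ∑ m ∈ Finset.range (s + 1), invSqrtTwo ^ (s - m) * ∫⁻ x, increment u m x ∂haarG := by
    intro s
    rw [lintegral_finsetSum _ fun k _ =>
      (measurable_translateSum_averagedIncrements u s k).const_mul _, mul_assoc]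
    refine le_trans (Finset.sum_le_sum fun k _ => ?_)
      ((Finset.sum_mul _ _ _).symm.trans_le (mul_le_mul_left (hv s) _))
    rw [lintegral_const_mul _ (measurable_translateSum_averagedIncrements u s k),
      ← lintegral_averagedIncrements hd s (k + 1)]
    gcongr
    exact lintegral_translateSum_le _ _ (measurable_averagedIncrements u s _)
  simp only [weightedRemainder]
  rw [lintegral_tsum fun s => (Finset.measurable_fun_sum _ fun k _ =>
    (measurable_translateSum_averagedIncrements u s k).const_mul _).aemeasurable]
  refine (ENNReal.tsum_le_tsum hlevel).trans_eq ?_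
  rw [ENNReal.tsum_mul_left, tsum_sum_range_pow_sub_mul]
  ring

end Majorants

section WeightedMaximal

/-- The maximal operator `sup_s sup_{k < s} w s k * |σ_{α_k^s} F|` with general weights. -/
def weightedMaximal (w : ℕ → ℕ → ℝ≥0∞) (F : ℕ → G → ℝ) (x : G) : ℝ≥0∞ :=
  ⨆ (s : ℕ) (k : ℕ) (_ : k < s), w s k * ‖fejerMean (alpha s k) F x‖ₑ

variable {w : ℕ → ℕ → ℝ≥0∞} {A : ℝ≥0} {F : ℕ → G → ℝ}

theorem measurable_weightedMaximal (w : ℕ → ℕ → ℝ≥0∞) (F : ℕ → G → ℝ) :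
    Measurable (weightedMaximal w F) := by
  have hfejer : ∀ j, Measurable (fejerMean j F) := fun j => by
    unfold fejerMean partialSum
    have := measurable_walsh
    fun_prop
  unfold weightedMaximal
  fun_prop

theorem weightedMaximal_rpow_le (hF : Martingale F dyadicFiltration haarG)
    (hw : ∀ s, ∑ k ∈ Finset.range s, w s k ^ (1 / 2 : ℝ) ≤ A) (x : G) :
    weightedMaximal w F x ^ (1 / 2 : ℝ) ≤
      3 * A * translateMajorant invSqrtTwo (rootRunningMax F) x +
        2 * weightedRemainder (fun s k => w s k ^ (1 / 2 : ℝ)) (rootRunningMax F) x := by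
  set u := rootRunningMax F
  set M := translateMajorant invSqrtTwo u x
  have hM : ∀ m, translateSum invSqrtTwo m (u m) x ≤ M := fun m =>
    translateSum_le_iSup_add_tsum (monotone_rootRunningMax F)
      (dependsOn_rootRunningMax (dependsOn_of_martingale hF)) invSqrtTwo_lt_one.le m x
  rw [← ENNReal.le_rpow_inv_iff one_half_pos]
  refine iSup_le fun s => iSup₂_le fun k hk => ?_
  rw [ENNReal.le_rpow_inv_iff one_half_pos, ENNReal.mul_rpow_of_nonneg _ _ one_half_pos.le]
  set v := w s k ^ (1 / 2 : ℝ)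
  set R := translateSum invSqrtTwo (k + 1) (averagedIncrements u s (k + 1)) x
  have hv : v ≤ A := (Finset.single_le_sum_of_canonicallyOrdered
    (f := fun k => w s k ^ (1 / 2 : ℝ)) (Finset.mem_range.mpr hk)).trans (hw s)
  have hR : v * R ≤ weightedRemainder (fun s k => w s k ^ (1 / 2 : ℝ)) u x :=
    (Finset.single_le_sum_of_canonicallyOrdered (f := fun k => w s k ^ (1 / 2 : ℝ) *
      translateSum invSqrtTwo (k + 1) (averagedIncrements u s (k + 1)) x)
      (Finset.mem_range.mpr hk)).trans (ENNReal.le_tsum s)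
  calc v * ‖fejerMean (alpha s k) F x‖ₑ ^ (1 / 2 : ℝ)
      ≤ v * (2 * M + M + 2 * R) := by
        gcongr
        refine (enorm_fejerMean_alpha_rpow_le hF hk x).trans ?_
        gcongr
        exacts [hM s, hM (k + 1)]
    _ = 3 * v * M + 2 * (v * R) := by ring
    _ ≤ _ := by gcongr

theorem lintegral_weightedMaximal_rpow_le (hF : Martingale F dyadicFiltration haarG)
    (hw : ∀ s, ∑ k ∈ Finset.range s, w s k ^ (1 / 2 : ℝ) ≤ A) :
    ∫⁻ x, weightedMaximal w F x ^ (1 / 2 : ℝ) ∂haarG ≤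
      A * (6 * (1 - invSqrtTwo)⁻¹ + 2 * (1 - invSqrtTwo)⁻¹ ^ 2) *
        ∫⁻ x, maximalFunction F x ^ (1 / 2 : ℝ) ∂haarG := by
  have hu := monotone_rootRunningMax F
  have hd := dependsOn_rootRunningMax (dependsOn_of_martingale hF)
  set u := rootRunningMax F
  set I := ∫⁻ x, maximalFunction F x ^ (1 / 2 : ℝ) ∂haarG
  set c := (1 - invSqrtTwo)⁻¹
  have hsup : ∫⁻ x, ⨆ m, u m x ∂haarG ≤ I := lintegral_mono (iSup_rootRunningMax_le F)
  calc ∫⁻ x, weightedMaximal w F x ^ (1 / 2 : ℝ) ∂haarG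
      ≤ ∫⁻ x, 3 * A * translateMajorant invSqrtTwo u x +
          2 * weightedRemainder (fun s k => w s k ^ (1 / 2 : ℝ)) u x ∂haarG :=
        lintegral_mono (weightedMaximal_rpow_le hF hw)
    _ = 3 * A * ∫⁻ x, translateMajorant invSqrtTwo u x ∂haarG +
          2 * ∫⁻ x, weightedRemainder (fun s k => w s k ^ (1 / 2 : ℝ)) u x ∂haarG := by
        have hR := measurable_weightedRemainder (fun s k => w s k ^ (1 / 2 : ℝ)) u
        rw [lintegral_add_right _ (hR.const_mul _), lintegral_const_mul' _ _ (by finiteness),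
          lintegral_const_mul _ hR]
    _ ≤ 3 * A * (2 * c * I) + 2 * (A * c ^ 2 * I) := by
        gcongr
        · exact (lintegral_translateMajorant_le _ hu hd).trans (by gcongr)
        · refine (lintegral_weightedRemainder_le hd hw).trans ?_
          gcongr
          exact (tsum_lintegral_increment_le hu hd).trans hsup
    _ = A * (6 * c + 2 * c ^ 2) * I := by ring

theorem eLpNorm_half {α : Type*} [MeasurableSpace α] (μ : Measure α) (f : α → ℝ≥0∞) :
    eLpNorm f (1 / 2) μ = (∫⁻ x, f x ^ (1 / 2 : ℝ) ∂μ) ^ (2 : ℝ) := by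
  have h : (1 / 2 : ℝ≥0∞).toReal = 1 / 2 := by simp
  rw [eLpNorm_eq_lintegral_rpow_enorm_toReal (by simp) (by simp), h]
  norm_num

theorem eLpNorm_weightedMaximal_le (hF : Martingale F dyadicFiltration haarG)
    (hw : ∀ s, ∑ k ∈ Finset.range s, w s k ^ (1 / 2 : ℝ) ≤ A) :
    eLpNorm (weightedMaximal w F) (1 / 2) haarG ≤
      (A * (6 * (1 - invSqrtTwo)⁻¹ + 2 * (1 - invSqrtTwo)⁻¹ ^ 2)) ^ (2 : ℝ) *
        hardyNorm (1 / 2) F := by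
  rw [hardyNorm, eLpNorm_half, eLpNorm_half, ← ENNReal.mul_rpow_of_nonneg _ _ two_pos.le]
  exact ENNReal.rpow_le_rpow (lintegral_weightedMaximal_rpow_le hF hw) two_pos.le

end WeightedMaximal

section LogWeight

/-- The normalization `log^{-2/n} α_k^s` on the range `k < [s^{1/n}]`, extended by zero. -/
def logWeight (n s k : ℕ) : ℝ≥0∞ :=
  if k < ⌊(s : ℝ) ^ (1 / (n : ℝ))⌋₊ then ENNReal.ofReal (Real.log (alpha s k) ^ (2 / (n : ℝ)))⁻¹
  else 0

variable {n : ℕ}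

theorem floor_rpow_one_div_le (hn : 1 ≤ n) (s : ℕ) : ⌊(s : ℝ) ^ (1 / (n : ℝ))⌋₊ ≤ s := by
  have hn' : (1 : ℝ) ≤ n := by exact_mod_cast hn
  rcases Nat.eq_zero_or_pos s with rfl | hs
  · rw [Nat.cast_zero, Real.zero_rpow (by positivity), Nat.floor_zero]
  · refine Nat.floor_le_of_le ?_
    have hs' : (1 : ℝ) ≤ s := by exact_mod_cast hs
    exact Real.rpow_le_self_of_one_le hs' ((div_le_one (by positivity)).mpr hn')

theorem half_mul_le_log_alpha (s k : ℕ) : (1 / 2 : ℝ) * s ≤ Real.log (alpha s k) := by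
  have hpow : (2 : ℝ) ^ s ≤ alpha s k := by exact_mod_cast Nat.le_add_right _ _
  calc (1 / 2 : ℝ) * s ≤ Real.log 2 * s := by
        gcongr
        linarith [Real.log_two_gt_d9]
    _ = Real.log (2 ^ s) := by rw [Real.log_pow, mul_comm]
    _ ≤ Real.log (alpha s k) := Real.log_le_log (by positivity) hpow

theorem half_floor_le_log_alpha_rpow (hn : 1 ≤ n) (s k : ℕ) :
    (1 / 2 : ℝ) * ⌊(s : ℝ) ^ (1 / (n : ℝ))⌋₊ ≤ Real.log (alpha s k) ^ (1 / (n : ℝ)) := by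
  have hn' : (1 : ℝ) ≤ n := by exact_mod_cast hn
  have hhalf : (1 / 2 : ℝ) ≤ (1 / 2) ^ (1 / (n : ℝ)) :=
    Real.self_le_rpow_of_le_one one_half_pos.le one_half_lt_one.le
      ((div_le_one (by positivity)).mpr hn')
  calc (1 / 2 : ℝ) * ⌊(s : ℝ) ^ (1 / (n : ℝ))⌋₊
      ≤ (1 / 2) ^ (1 / (n : ℝ)) * (s : ℝ) ^ (1 / (n : ℝ)) := by
        gcongr
        exact Nat.floor_le (by positivity)
    _ = ((1 / 2) * s) ^ (1 / (n : ℝ)) := (Real.mul_rpow one_half_pos.le (by positivity)).symm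
    _ ≤ _ := Real.rpow_le_rpow (by positivity) (half_mul_le_log_alpha s k) (by positivity)

theorem logWeight_rpow_le (hn : 1 ≤ n) {s k : ℕ} (hk : k < ⌊(s : ℝ) ^ (1 / (n : ℝ))⌋₊) :
    logWeight n s k ^ (1 / 2 : ℝ) ≤ 2 * (⌊(s : ℝ) ^ (1 / (n : ℝ))⌋₊ : ℝ≥0∞)⁻¹ := by
  set r := ⌊(s : ℝ) ^ (1 / (n : ℝ))⌋₊
  have hr₀ : (0 : ℝ) < r := by exact_mod_cast k.zero_le.trans_lt hk
  have hlog : 0 ≤ Real.log (alpha s k) := Real.log_natCast_nonneg _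
  have hroot : ((Real.log (alpha s k) ^ (2 / (n : ℝ)))⁻¹) ^ (1 / 2 : ℝ) =
      (Real.log (alpha s k) ^ (1 / (n : ℝ)))⁻¹ := by
    rw [Real.inv_rpow (by positivity), ← Real.rpow_mul hlog]
    congr 2
    ring
  rw [logWeight, if_pos hk, ENNReal.ofReal_rpow_of_nonneg (by positivity) one_half_pos.le, hroot]
  calc ENNReal.ofReal (Real.log (alpha s k) ^ (1 / (n : ℝ)))⁻¹
      ≤ ENNReal.ofReal (1 / 2 * r)⁻¹ := by
        gcongr
        exact half_floor_le_log_alpha_rpow hn s k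
    _ = 2 * (r : ℝ≥0∞)⁻¹ := by
        rw [mul_inv, one_div, inv_inv, ENNReal.ofReal_mul two_pos.le, ENNReal.ofReal_ofNat,
          ENNReal.ofReal_inv_of_pos hr₀, ENNReal.ofReal_natCast]

theorem sum_logWeight_rpow_le (hn : 1 ≤ n) (s : ℕ) :
    ∑ k ∈ Finset.range s, logWeight n s k ^ (1 / 2 : ℝ) ≤ 2 := by
  set r := ⌊(s : ℝ) ^ (1 / (n : ℝ))⌋₊
  have hzero : ∀ k ∈ Finset.range s, k ∉ Finset.range r → logWeight n s k ^ (1 / 2 : ℝ) = 0 := by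
    intro k _ hk
    rw [logWeight, if_neg fun h => hk (Finset.mem_range.mpr h),
      ENNReal.zero_rpow_of_pos one_half_pos]
  calc ∑ k ∈ Finset.range s, logWeight n s k ^ (1 / 2 : ℝ)
      = ∑ k ∈ Finset.range r, logWeight n s k ^ (1 / 2 : ℝ) :=
        (Finset.sum_subset (Finset.range_subset_range.mpr (floor_rpow_one_div_le hn s)) hzero).symm
    _ ≤ ∑ _k ∈ Finset.range r, 2 * (r : ℝ≥0∞)⁻¹ :=
        Finset.sum_le_sum fun k hk => logWeight_rpow_le hn (Finset.mem_range.mp hk)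
    _ = 2 * (r * (r : ℝ≥0∞)⁻¹) := by
        rw [Finset.sum_const, Finset.card_range, nsmul_eq_mul, mul_left_comm]
    _ ≤ 2 := mul_le_of_le_one_right' (ENNReal.mul_inv_le_one _)

theorem restrictedMaximal_eq_weightedMaximal (hn : 1 ≤ n) (F : ℕ → G → ℝ) :
    restrictedMaximal n F = weightedMaximal (logWeight n) F := by
  funext x
  have hweight : ∀ s k : ℕ, k < ⌊(s : ℝ) ^ (1 / (n : ℝ))⌋₊ →
      logWeight n s k * ‖fejerMean (alpha s k) F x‖ₑ =
        ENNReal.ofReal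
          (|fejerMean (alpha s k) F x| / Real.log (alpha s k) ^ (2 / (n : ℝ))) := by
    intro s k hk
    have := Real.log_natCast_nonneg (alpha s k)
    rw [logWeight, if_pos hk, Real.enorm_eq_ofReal_abs, ← ENNReal.ofReal_mul (by positivity),
      inv_mul_eq_div]
  refine le_antisymm ?_ ?_
  · refine iSup_mono fun s => iSup₂_le fun k hk => ?_
    rw [← hweight s k hk]
    exact le_iSup₂_of_le k (hk.trans_le (floor_rpow_one_div_le hn s)) le_rfl
  · refine iSup_mono fun s => iSup₂_le fun k _ => ?_
    by_cases hk : k < ⌊(s : ℝ) ^ (1 / (n : ℝ))⌋₊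
    · rw [hweight s k hk]
      exact le_iSup₂_of_le k hk le_rfl
    · rw [logWeight, if_neg hk, zero_mul]
      exact zero_le

end LogWeight

end WalshFejer

end

theorem corollary5_general (w : ℕ → ℕ → ℝ≥0∞) {A : ℝ≥0}
    (hw : ∀ s, ∑ k ∈ Finset.range s, w s k ^ (1 / 2 : ℝ) ≤ A) :
    ∃ c : ℝ≥0, ∀ F : ℕ → WalshFejer.G → ℝ, WalshFejer.MemHardy (1 / 2) F →
      MemLp (WalshFejer.weightedMaximal w F) (1 / 2) WalshFejer.haarG ∧
      eLpNorm (WalshFejer.weightedMaximal w F) (1 / 2) WalshFejer.haarG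
        ≤ c * WalshFejer.hardyNorm (1 / 2) F := by
  set c := (A * (6 * (1 - WalshFejer.invSqrtTwo)⁻¹ + 2 * (1 - WalshFejer.invSqrtTwo)⁻¹ ^ 2)) ^
    (2 : ℝ)
  have hsub : 1 - WalshFejer.invSqrtTwo ≠ 0 := (tsub_pos_of_lt WalshFejer.invSqrtTwo_lt_one).ne'
  have hc : c ≠ ∞ := ENNReal.rpow_ne_top_of_nonneg two_pos.le (by finiteness)
  refine ⟨c.toNNReal, fun F hF => ?_⟩
  rw [ENNReal.coe_toNNReal hc]
  have hle := WalshFejer.eLpNorm_weightedMaximal_le hF.1 hw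
  exact ⟨⟨(WalshFejer.measurable_weightedMaximal w F).aestronglyMeasurable,
    hle.trans_lt (ENNReal.mul_lt_top hc.lt_top hF.2)⟩, hle⟩

theorem corollary5 (n : ℕ) (hn : 1 ≤ n) :
    ∃ c : ℝ≥0, ∀ F : ℕ → WalshFejer.G → ℝ, WalshFejer.MemHardy (1 / 2) F →
      MemLp (WalshFejer.restrictedMaximal n F) (1 / 2) WalshFejer.haarG ∧
      eLpNorm (WalshFejer.restrictedMaximal n F) (1 / 2) WalshFejer.haarG
        ≤ c * WalshFejer.hardyNorm (1 / 2) F := by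
  simpa only [WalshFejer.restrictedMaximal_eq_weightedMaximal hn] using
    corollary5_general (WalshFejer.logWeight n) (A := 2) (WalshFejer.sum_logWeight_rpow_le hn)
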